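/- Let counting logic over the signature $\{\min,\max,<,\mathrm{succ}\}$ of linear orders (constants $\min,\max$; binary relations $<$ and $\mathrm{succ}$, the immediate-successor relation) be built from the atomic formulas $a=b$, $a<b$, $\mathrm{succ}(a,b)$ (with $a,b$ variables, $\min$ or $\max$) by $\neg,\vee,\wedge$ and the quantifiers $\exists^{\ge k}x$ ("at least $k$ elements $x$ satisfy") and $\forall^{\ge k}x:=\neg\exists^{\ge k}x\,\neg$; thus $\exists=\exists^{\ge 1}$ and $\forall=\forall^{\ge 1}$. The size $|\phi|$ is given by $|\phi|=1$ for atomic $\phi$, $|\neg\phi|=|\exists^{\ge k}x\,\phi|=|\forall^{\ge k}x\,\phi|=|\phi|+1$ and $|\phi\vee\psi|=|\phi\wedge\psi|=|\phi|+|\psi|$. The counting rank of $\phi$ is the largest $k$ occurring in a quantifier $\exists^{\ge k}$ or $\forall^{\ge k}$ of $\phi$ ($0$ if there is none). Let $\mathcal A_n$ be the linear order $(\{0,\dots,n\},<)$, in which $\min$, $\max$ and $\mathrm{succ}$ have their natural meaning. **Theorem.** Let $t\ge 1$, let $n<m$ be natural numbers, and let $\phi$ be a counting logic formula with at most three variables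 $x,y,z$ and counting rank at most $t$. If $\phi$ distinguishes $\mathcal A_n$ from $\mathcal A_m$, i.e. $\mathcal A_n\models\phi$ and $\mathcal A_m\models\neg\phi$ (if $\phi$ has free variables: under all assignments), then $$|\phi|\ \ge\ \frac{\sqrt n}{t}.$$ -/

import Mathlib

namespace CountingLogic

/-- Terms over the constants `min`, `max` with `m` variables. -/
inductive Term (m : ℕ) : Type
  | var (j : Fin m)
  | min
  | max

/-- Formulas of counting logic with `m` variables over the signature `{min, max, <, succ}` of
linear orders, with equality; `<` and `succ` are binary relation symbols, `min` and `max` are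
constants. The first-order quantifiers `∃` and `∀` are `∃^{≥ 1}` and `∀^{≥ 1}`. -/
inductive Formula (m : ℕ) : Type
  | eq (a b : Term m)
  | lt (a b : Term m)
  | succ (a b : Term m)
  | neg (φ : Formula m)
  | or (φ ψ : Formula m)
  | and (φ ψ : Formula m)
  /-- `∃^{≥ k} x_j φ` -/
  | existsGE (k : ℕ) (j : Fin m) (φ : Formula m)
  /-- `∀^{≥ k} x_j φ` -/
  | forallGE (k : ℕ) (j : Fin m) (φ : Formula m)

/-- The size `|φ|`: atomic formulas have size `1`, negations and quantifiers add `1`, and the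
size of a disjunction or conjunction is the sum of the sizes of its two parts. -/
def Formula.size {m : ℕ} : Formula m → ℕ
  | .eq _ _ => 1
  | .lt _ _ => 1
  | .succ _ _ => 1
  | .neg φ => φ.size + 1
  | .or φ ψ => φ.size + ψ.size
  | .and φ ψ => φ.size + ψ.size
  | .existsGE _ _ φ => 1 + φ.size
  | .forallGE _ _ φ => 1 + φ.size

/-- The maximum of the counting ranks `k` of the quantifiers of the formula (`0` if there is no
quantifier). -/
def Formula.countingRank {m : ℕ} : Formula m → ℕ
  | .eq _ _ => 0
  | .lt _ _ => 0
  | .succ _ _ => 0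
  | .neg φ => φ.countingRank
  | .or φ ψ => Nat.max φ.countingRank ψ.countingRank
  | .and φ ψ => Nat.max φ.countingRank ψ.countingRank
  | .existsGE k _ φ => Nat.max k φ.countingRank
  | .forallGE k _ φ => Nat.max k φ.countingRank

/-- The value of a term in a linear order with endpoints under the assignment `α`. -/
def Term.val {m : ℕ} {U : Type*} [LinearOrder U] [BoundedOrder U] (α : Fin m → U) : Term m → U
  | .var j => α j
  | .min => ⊥
  | .max => ⊤

/-- At least `k` distinct elements satisfy `P`. -/
def AtLeast {U : Type*} (k : ℕ) (P : U → Prop) : Prop :=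
  ∃ s : Finset U, s.card = k ∧ ∀ a ∈ s, P a

/-- Satisfaction of a formula in a linear order with endpoints under an assignment of the `m`
variables: `min`, `max` denote the endpoints and `succ(a, b)` says that `b` is the immediate
successor of `a`. The quantifier `∀^{≥ k} x` abbreviates `¬ ∃^{≥ k} x ¬`. -/
def Formula.Sat {m : ℕ} {U : Type*} [LinearOrder U] [BoundedOrder U] :
    Formula m → (Fin m → U) → Prop
  | .eq a b, α => a.val α = b.val α
  | .lt a b, α => a.val α < b.val α
  | .succ a b, α => a.val α ⋖ b.val α
  | .neg φ, α => ¬ φ.Sat α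
  | .or φ ψ, α => φ.Sat α ∨ ψ.Sat α
  | .and φ ψ, α => φ.Sat α ∧ ψ.Sat α
  | .existsGE k j φ, α => AtLeast k fun a : U => φ.Sat (Function.update α j a)
  | .forallGE k j φ, α => ¬ AtLeast k fun a : U => ¬ φ.Sat (Function.update α j a)

/-- `φ` distinguishes `U` from `V`: it holds in `U` and its negation holds in `V`. For a sentence
the assignments are irrelevant; if `φ` has free variables, this is required of all of them. -/
def Formula.Distinguishes {m : ℕ} (φ : Formula m) (U V : Type*) [LinearOrder U] [BoundedOrder U]
    [LinearOrder V] [BoundedOrder V] : Prop :=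
  (∀ α : Fin m → U, φ.Sat α) ∧ (∀ β : Fin m → V, φ.neg.Sat β)

/-- The linear order `({0, …, n}, <)`. -/
abbrev LinOrd (n : ℕ) : Type := Fin (n + 1)

end CountingLogic

namespace CountingLogic

/-! Each formula gets thresholds δ(u, v) on pairs of terms such that its truth depends only on the
differences of the values truncated at δ. An atom needs 2 on one pair, connectives take maxima, and
a quantifier over x raises δ(u, v) to at least δ(u, x) + δ(x, v) + t - 1: then up to t candidates
for x of one type can be matched in the other order (`exists_finset_of_clamp_eq`).

With three variables, quantifying x leaves a single pair of other variables. So if two sides of the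
triangle of variables are measured together, a quantifier adds only t - 1 to them, and the
thresholds at min and max grow by an amount linear in this measure (`Bounded.quantThreshold`). The
border bound is thus quadratic in the size (`exists_invariant`, `border_le_sq`), and orders at least
that long agree once all variables sit at the minimum (`Invariant.lt_of_distinguishes`). -/

/-! ### Truncated integers -/

/-- The integer `x` truncated to the interval `[-d, d]`. -/
def clamp (d : ℕ) (x : ℤ) : ℤ := max (-d) (min d x)

theorem clamp_eq_clamp_iff {d : ℕ} {x y : ℤ} :
    clamp d x = clamp d y ↔ d = 0 ∨ x = y ∨ (d ≤ x ∧ d ≤ y) ∨ (x ≤ -d ∧ y ≤ -d) := by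
  unfold clamp; omega

theorem clamp_mono {d e : ℕ} (h : d ≤ e) {x y : ℤ} (hxy : clamp e x = clamp e y) :
    clamp d x = clamp d y := by
  rw [clamp_eq_clamp_iff] at *; omega

theorem clamp_neg (d : ℕ) (x : ℤ) : clamp d (-x) = -clamp d x := by
  unfold clamp; omega

theorem neg_le_clamp (d : ℕ) (x : ℤ) : -d ≤ clamp d x := by
  unfold clamp; omega

theorem clamp_le (d : ℕ) (x : ℤ) : clamp d x ≤ d := by
  unfold clamp; omega

theorem clamp_eq_of_bounds {d : ℕ} {τ y : ℤ} (h₁ : -d ≤ τ) (h₂ : τ ≤ d)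
    (hlo : τ < d → y ≤ τ) (hhi : -d < τ → τ ≤ y) : clamp d y = τ := by
  unfold clamp; omega

theorem le_of_clamp_lt {d : ℕ} {τ y : ℤ} (h : clamp d y = τ) (hτ : τ < d) : y ≤ τ := by
  unfold clamp at h; omega

theorem le_of_lt_clamp {d : ℕ} {τ y : ℤ} (h : clamp d y = τ) (hτ : -d < τ) : τ ≤ y := by
  unfold clamp at h; omega

/-- A lower bound on a difference is transferred along equality of truncations. -/
theorem le_of_clamp_eq {d : ℕ} {x y T : ℤ} (h : clamp d x = clamp d y) (hx : T ≤ x)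
    (h₁ : -d < T) (h₂ : T ≤ d) : T ≤ y := by
  rw [clamp_eq_clamp_iff] at h; omega

/-! ### Transfer of finite sets of points -/

/-- Helly's theorem on the line: pairwise compatibility of lower and upper bounds suffices. -/
theorem exists_interval {ι : Type*} [Finite ι] [Nonempty ι] (lo hi : ι → ℤ) (K : ℤ)
    (h : ∀ i j, K ≤ hi j - lo i) :
    ∃ l r : ℤ, K ≤ r - l ∧ (∀ i, lo i ≤ l) ∧ ∀ i, r ≤ hi i := by
  obtain ⟨i, hi'⟩ := Finite.exists_max lo
  obtain ⟨j, hj'⟩ := Finite.exists_min hi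
  exact ⟨lo i, hi j, h i j, hi', hj'⟩

theorem card_le_of_bounds {S : Finset ℤ} {l r : ℤ} (hlr : l ≤ r + 1)
    (h : ∀ x ∈ S, l ≤ x ∧ x ≤ r) : (S.card : ℤ) ≤ r - l + 1 := by
  have h1 : S ⊆ Finset.Icc l r := fun x hx => Finset.mem_Icc.2 (h x hx)
  have h2 := Finset.card_le_card h1
  rw [Int.card_Icc] at h2
  omega

/-- If the mutual distances of the points `a i` and `a' i` agree up to sufficiently large thresholds,
then a set of at most `t` points between `a p` and `a q` that have the same truncated distances to
all `a i` has a counterpart for `a'`. -/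
theorem exists_finset_of_clamp_eq {ι : Type*} [Finite ι] (a a' : ι → ℤ) (d : ι → ℕ)
    (δ : ι → ι → ℕ) (t : ℕ) (hδ : ∀ u v, d u + d v + (t - 1) ≤ δ u v)
    (hag : ∀ u v, clamp (δ u v) (a u - a v) = clamp (δ u v) (a' u - a' v))
    (p q : ι) (hpq : a' p ≤ a' q) (S : Finset ℤ) (hS : S.card ≤ t) (τ : ι → ℤ)
    (hSpq : ∀ x ∈ S, a p ≤ x ∧ x ≤ a q) (hτ : ∀ x ∈ S, ∀ u, clamp (d u) (a u - x) = τ u) :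
    ∃ S' : Finset ℤ, S'.card = S.card ∧ (∀ x ∈ S', a' p ≤ x ∧ x ≤ a' q) ∧
      ∀ x ∈ S', ∀ u, clamp (d u) (a' u - x) = τ u := by
  classical
  rcases S.eq_empty_or_nonempty with rfl | hne
  · exact ⟨∅, rfl, by simp, by simp⟩
  have : Nonempty ι := ⟨p⟩
  have hmin := S.min'_mem hne
  have hmax := S.max'_mem hne
  set x₀ := S.min' hne
  set x₁ := S.max' hne
  have hx₀₁ : x₀ ≤ x₁ := S.min'_le _ hmax
  have hcard : (S.card : ℤ) ≤ x₁ - x₀ + 1 :=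
    card_le_of_bounds (by omega) fun x hx => ⟨S.min'_le x hx, S.le_max' x hx⟩
  have hpos : 0 < S.card := hne.card_pos
  have hτl : ∀ u, -(d u : ℤ) ≤ τ u := fun u => hτ x₀ hmin u ▸ neg_le_clamp _ _
  have hτr : ∀ u, τ u ≤ d u := fun u => hτ x₀ hmin u ▸ clamp_le _ _
  have hl : ∀ u, τ u < d u → a u - x₀ ≤ τ u := fun u h => le_of_clamp_lt (hτ x₀ hmin u) h
  have hr : ∀ u, -(d u : ℤ) < τ u → τ u ≤ a u - x₁ := fun u h => le_of_lt_clamp (hτ x₁ hmax u) h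
  have hp := (hSpq x₀ hmin).1
  have hq := (hSpq x₁ hmax).2
  -- A truncated distance `τ u` bounds the new points below unless it is `d u`, and above unless it
  -- is `-d u`; the endpoints `a' p`, `a' q` replace a missing bound.
  obtain ⟨l, r, hlr, hlo, hhi⟩ := exists_interval
    (fun u => max (a' p) (if τ u < d u then a' u - τ u else a' p))
    (fun u => min (a' q) (if -(d u : ℤ) < τ u then a' u - τ u else a' q)) (S.card - 1) (by
      intro u v
      have huv : τ u < d u → -(d v : ℤ) < τ v →
          (S.card : ℤ) - 1 ≤ (a' v - τ v) - (a' u - τ u) := by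
        intro h1 h2
        have := hl u h1
        have := hr v h2
        have := hτl u
        have := hτr v
        have := hδ v u
        have := le_of_clamp_eq (T := τ v - τ u + (S.card - 1)) (hag v u)
          (by omega) (by omega) (by omega)
        omega
      have huq : τ u < d u → (S.card : ℤ) - 1 ≤ a' q - (a' u - τ u) := by
        intro h1
        have := hl u h1
        have := hτl u
        have := hδ q u
        have := le_of_clamp_eq (T := - τ u + (S.card - 1)) (hag q u)
          (by omega) (by omega) (by omega)
        omega
      have hpv : -(d v : ℤ) < τ v → (S.card : ℤ) - 1 ≤ (a' v - τ v) - a' p := by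
        intro h1
        have := hr v h1
        have := hτr v
        have := hδ v p
        have := le_of_clamp_eq (T := τ v + (S.card - 1)) (hag v p)
          (by omega) (by omega) (by omega)
        omega
      -- `hpq` matters when `δ q p = 0`: truncation then says nothing, but `S` is a single point.
      have hpq' : (S.card : ℤ) - 1 ≤ a' q - a' p := by
        have h1 := hδ q p
        have h2 := hag q p
        rw [clamp_eq_clamp_iff] at h2
        omega
      split_ifs with h2 h1 h1
      · have := huv h1 h2
        have := huq h1
        have := hpv h2
        omega
      · have := hpv h2
        omega
      · have := huq h1
        omega
      · omega)
  obtain ⟨S', hS'sub, hS'card⟩ := Finset.exists_subset_card_eq (s := Finset.Icc l r) (n := S.card)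
    (by rw [Int.card_Icc]; omega)
  have hmem : ∀ x ∈ S', l ≤ x ∧ x ≤ r := fun x hx => Finset.mem_Icc.1 (hS'sub hx)
  refine ⟨S', hS'card, fun x hx => ?_, fun x hx u => ?_⟩
  · have := hmem x hx
    have h1 := hlo p
    have h2 := hhi p
    exact ⟨(le_max_left _ _).trans (h1.trans this.1), this.2.trans (h2.trans (min_le_left _ _))⟩
  · have hx' := hmem x hx
    have h1 := (le_max_right _ _).trans ((hlo u).trans hx'.1)
    have h2 := hx'.2.trans ((hhi u).trans (min_le_right _ _))
    refine clamp_eq_of_bounds (hτl u) (hτr u) (fun h => ?_) (fun h => ?_)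
    · rw [if_pos h] at h1; omega
    · rw [if_pos h] at h2; omega

/-- If every set of at most `t` elements of the same type has a counterpart of that type in `V`,
then so has every set of at most `t` elements. -/
theorem AtLeast.transfer {U V T : Type*} (f : U → T) (g : V → T) {k : ℕ} {P : U → Prop}
    {Q : V → Prop} (hPQ : ∀ x y, f x = g y → P x → Q y)
    (h : ∀ (τ : T) (S : Finset U), S.card ≤ k → (∀ x ∈ S, f x = τ) →
      ∃ S' : Finset V, S'.card = S.card ∧ ∀ y ∈ S', g y = τ)
    (hP : AtLeast k P) : AtLeast k Q := by
  classical
  obtain ⟨S, hS, hSP⟩ := hP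
  choose F hFcard hF using fun τ : T => h τ (S.filter fun x => f x = τ)
    ((Finset.card_filter_le _ _).trans hS.le) fun x hx => (Finset.mem_filter.1 hx).2
  -- Counterparts of different types are disjoint, so their cardinalities add up.
  refine ⟨(S.image f).biUnion F, ?_, fun y hy => ?_⟩
  · rw [Finset.card_biUnion, ← hS,
      Finset.card_eq_sum_card_image f S]
    · exact Finset.sum_congr rfl fun τ _ => hFcard τ
    · intro τ _ τ' _ hne
      exact Finset.disjoint_left.2 fun y hy hy' => hne ((hF τ y hy).symm.trans (hF τ' y hy'))
  · obtain ⟨τ, hτ, hy⟩ := Finset.mem_biUnion.1 hy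
    obtain ⟨x, hx, rfl⟩ := Finset.mem_image.1 hτ
    exact hPQ x y (hF _ y hy).symm (hSP x hx)

/-! ### Truncated differences of terms and quantifier moves -/

instance Term.instFinite (m : ℕ) : Finite (Term m) :=
  Finite.of_surjective (fun o : Option (Option (Fin m)) => match o with
    | none => Term.min
    | some none => Term.max
    | some (some j) => Term.var j) (by
      rintro (j | _ | _)
      exacts [⟨some (some j), rfl⟩, ⟨none, rfl⟩, ⟨some none, rfl⟩])

/-- The position of the value of a term. -/
def Term.pos {m n : ℕ} (α : Fin m → LinOrd n) (u : Term m) : ℤ := ((u.val α : LinOrd n) : ℕ)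

/-- The differences between the values of any two terms agree after truncation at the thresholds
`δ`. -/
def Agree {m : ℕ} (δ : Term m → Term m → ℕ) {n n' : ℕ} (α : Fin m → LinOrd n)
    (β : Fin m → LinOrd n') : Prop :=
  ∀ u v, clamp (δ u v) (u.pos α - v.pos α) = clamp (δ u v) (u.pos β - v.pos β)

theorem Agree.symm {m : ℕ} {δ : Term m → Term m → ℕ} {n n' : ℕ} {α : Fin m → LinOrd n}
    {β : Fin m → LinOrd n'} (h : Agree δ α β) : Agree δ β α :=
  fun u v => (h u v).symm

theorem Agree.mono {m : ℕ} {δ δ' : Term m → Term m → ℕ} (hδ : ∀ u v, δ u v ≤ δ' u v) {n n' : ℕ}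
    {α : Fin m → LinOrd n} {β : Fin m → LinOrd n'} (h : Agree δ' α β) : Agree δ α β :=
  fun u v => clamp_mono (hδ u v) (h u v)

/-- The truth value of `φ` is determined by the differences truncated at `δ`. -/
def Invariant {m : ℕ} (φ : Formula m) (δ : Term m → Term m → ℕ) : Prop :=
  ∀ ⦃n n' : ℕ⦄ ⦃α : Fin m → LinOrd n⦄ ⦃β : Fin m → LinOrd n'⦄, Agree δ α β → φ.Sat α → φ.Sat β

open Classical in
/-- The thresholds that are needed to answer a move of the variable `j`. -/
noncomputable def quantThreshold {m : ℕ} (t : ℕ) (j : Fin m) (δ : Term m → Term m → ℕ)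
    (u v : Term m) : ℕ :=
  if u = .var j ∨ v = .var j then 0
  else max (δ u v) (δ u (.var j) + δ (.var j) v + (t - 1))

theorem Term.pos_update_of_ne {m n : ℕ} (α : Fin m → LinOrd n) (j : Fin m) (a : LinOrd n)
    {u : Term m} (hu : u ≠ .var j) : u.pos (Function.update α j a) = u.pos α := by
  cases u with
  | var i =>
    have : i ≠ j := fun h => hu (h ▸ rfl)
    simp [Term.pos, Term.val, Function.update_of_ne this]
  | min => rfl
  | max => rfl

theorem Term.pos_update_self {m n : ℕ} (α : Fin m → LinOrd n) (j : Fin m) (a : LinOrd n) :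
    (Term.var j).pos (Function.update α j a) = (a : ℕ) := by
  simp [Term.pos, Term.val]

theorem Term.pos_min {m n : ℕ} (α : Fin m → LinOrd n) : (Term.min : Term m).pos α = 0 := by
  simp [Term.pos, Term.val, bot_eq_zero]

theorem Term.pos_max {m n : ℕ} (α : Fin m → LinOrd n) : (Term.max : Term m).pos α = n := by
  simp [Term.pos, Term.val, Fin.top_eq_last]

/-- The truncated differences between `a` and the values of the terms other than `j`. -/
def moveType {m n : ℕ} (δ : Term m → Term m → ℕ) (j : Fin m) (α : Fin m → LinOrd n)
    (a : LinOrd n) (u : {u : Term m // u ≠ .var j}) : ℤ :=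
  clamp (δ u.1 (.var j)) (u.1.pos α - (a : ℕ))

theorem agree_update {m : ℕ} {δ : Term m → Term m → ℕ} (hsymm : ∀ u v, δ u v = δ v u) {t : ℕ}
    {j : Fin m} {n n' : ℕ} {α : Fin m → LinOrd n} {β : Fin m → LinOrd n'}
    (h : Agree (quantThreshold t j δ) α β) {a : LinOrd n} {b : LinOrd n'}
    (hab : moveType δ j α a = moveType δ j β b) :
    Agree δ (Function.update α j a) (Function.update β j b) := by
  intro u v
  by_cases hu : u = .var j <;> by_cases hv : v = .var j
  · subst hu hv
    simp
  · subst hu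
    have := congrFun hab ⟨v, hv⟩
    simp only [moveType] at this
    rw [Term.pos_update_self, Term.pos_update_self, Term.pos_update_of_ne _ _ _ hv,
      Term.pos_update_of_ne _ _ _ hv, hsymm, ← neg_sub, clamp_neg, this, ← clamp_neg, neg_sub]
  · subst hv
    have := congrFun hab ⟨u, hu⟩
    simp only [moveType] at this
    rw [Term.pos_update_self, Term.pos_update_self, Term.pos_update_of_ne _ _ _ hu,
      Term.pos_update_of_ne _ _ _ hu, this]
  · rw [Term.pos_update_of_ne _ _ _ hu, Term.pos_update_of_ne _ _ _ hv,
      Term.pos_update_of_ne _ _ _ hu, Term.pos_update_of_ne _ _ _ hv]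
    refine clamp_mono ?_ (h u v)
    rw [quantThreshold, if_neg (by tauto)]
    exact le_max_left _ _

theorem exists_finset_moveType {m : ℕ} {δ : Term m → Term m → ℕ} (hsymm : ∀ u v, δ u v = δ v u)
    {t : ℕ} {j : Fin m} {n n' : ℕ} {α : Fin m → LinOrd n} {β : Fin m → LinOrd n'}
    (h : Agree (quantThreshold t j δ) α β) (τ : {u : Term m // u ≠ .var j} → ℤ)
    (S : Finset (LinOrd n)) (hS : S.card ≤ t) (hτ : ∀ a ∈ S, moveType δ j α a = τ) :
    ∃ S' : Finset (LinOrd n'), S'.card = S.card ∧ ∀ b ∈ S', moveType δ j β b = τ := by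
  classical
  have hinj : Function.Injective fun a : LinOrd n => ((a : ℕ) : ℤ) := by
    intro a b hab
    exact Fin.ext (by simpa using hab)
  obtain ⟨S', hcard, hrange, hS'⟩ := exists_finset_of_clamp_eq
    (fun u : {u : Term m // u ≠ .var j} => u.1.pos α) (fun u => u.1.pos β)
    (fun u => δ u.1 (.var j)) (fun u v => quantThreshold t j δ u.1 v.1) t
    (fun u v => by
      rw [quantThreshold, if_neg (by simp [u.2, v.2]), hsymm v.1]
      exact le_max_right _ _)
    -- Taking min and max as the enclosing points keeps the new integers inside `LinOrd n'`.
    (fun u v => h u.1 v.1) ⟨.min, by simp⟩ ⟨.max, by simp⟩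
    (by simp [Term.pos_min, Term.pos_max]) (S.image fun a : LinOrd n => ((a : ℕ) : ℤ))
    (by rwa [Finset.card_image_of_injective _ hinj]) τ
    (by
      intro x hx
      obtain ⟨a, -, rfl⟩ := Finset.mem_image.1 hx
      simp only [Term.pos_min, Term.pos_max]
      have := a.2
      omega)
    (by
      intro x hx u
      obtain ⟨a, ha, rfl⟩ := Finset.mem_image.1 hx
      exact congrFun (hτ a ha) u)
  rw [Finset.card_image_of_injective _ hinj] at hcard
  simp only [Term.pos_min, Term.pos_max] at hrange
  refine ⟨S'.attach.image fun x => ⟨x.1.toNat, by have := hrange x.1 x.2; omega⟩, ?_, ?_⟩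
  · rw [Finset.card_image_of_injOn, Finset.card_attach, hcard]
    intro x _ y _ hxy
    have := hrange x.1 x.2
    have := hrange y.1 y.2
    have hxy' := congrArg Fin.val hxy
    exact Subtype.ext (by simp only at hxy'; omega)
  · intro b hb
    obtain ⟨x, -, rfl⟩ := Finset.mem_image.1 hb
    funext u
    rw [← hS' x.1 x.2 u]
    have := (hrange x.1 x.2).1
    simp only [moveType]
    rw [Int.toNat_of_nonneg this]

theorem atLeast_update {m : ℕ} {δ : Term m → Term m → ℕ} (hsymm : ∀ u v, δ u v = δ v u)
    {t k : ℕ} (hk : k ≤ t) {j : Fin m} {φ : Formula m} (hφ : Invariant φ δ) {n n' : ℕ}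
    {α : Fin m → LinOrd n} {β : Fin m → LinOrd n'} (h : Agree (quantThreshold t j δ) α β)
    (hα : AtLeast k fun a => φ.Sat (Function.update α j a)) :
    AtLeast k fun b => φ.Sat (Function.update β j b) :=
  hα.transfer (moveType δ j α) (moveType δ j β)
    (fun _ _ hab => hφ (agree_update hsymm h hab))
    fun τ S hS => exists_finset_moveType hsymm h τ S (hS.trans hk)

/-! ### Thresholds for each formula constructor -/

theorem Invariant.neg {m : ℕ} {φ : Formula m} {δ : Term m → Term m → ℕ} (h : Invariant φ δ) :
    Invariant φ.neg δ :=
  fun _ _ _ _ hag hα hβ => hα (h hag.symm hβ)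

theorem Invariant.existsGE {m : ℕ} {φ : Formula m} {δ : Term m → Term m → ℕ}
    (hsymm : ∀ u v, δ u v = δ v u) {t k : ℕ} (hk : k ≤ t) (j : Fin m) (h : Invariant φ δ) :
    Invariant (.existsGE k j φ) (quantThreshold t j δ) :=
  fun _ _ _ _ hag hα => atLeast_update hsymm hk h hag hα

theorem Invariant.forallGE {m : ℕ} {φ : Formula m} {δ : Term m → Term m → ℕ}
    (hsymm : ∀ u v, δ u v = δ v u) {t k : ℕ} (hk : k ≤ t) (j : Fin m) (h : Invariant φ δ) :
    Invariant (.forallGE k j φ) (quantThreshold t j δ) :=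
  fun _ _ _ _ hag hα hβ => hα (atLeast_update hsymm hk h.neg hag.symm hβ)

theorem Invariant.or {m : ℕ} {φ ψ : Formula m} {δ δ' : Term m → Term m → ℕ} (h : Invariant φ δ)
    (h' : Invariant ψ δ') : Invariant (.or φ ψ) fun u v => max (δ u v) (δ' u v) :=
  fun _ _ _ _ hag => Or.imp (h (hag.mono fun _ _ => le_max_left _ _))
    (h' (hag.mono fun _ _ => le_max_right _ _))

theorem Invariant.and {m : ℕ} {φ ψ : Formula m} {δ δ' : Term m → Term m → ℕ} (h : Invariant φ δ)
    (h' : Invariant ψ δ') : Invariant (.and φ ψ) fun u v => max (δ u v) (δ' u v) :=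
  fun _ _ _ _ hag => And.imp (h (hag.mono fun _ _ => le_max_left _ _))
    (h' (hag.mono fun _ _ => le_max_right _ _))

open Classical in
/-- The thresholds that are needed for an atomic formula with the terms `a` and `b`. -/
noncomputable def atomThreshold {m : ℕ} (a b u v : Term m) : ℕ :=
  if (u = a ∧ v = b) ∨ (u = b ∧ v = a) then 2 else 0

theorem Agree.atom {m : ℕ} {a b : Term m} {n n' : ℕ} {α : Fin m → LinOrd n}
    {β : Fin m → LinOrd n'} (h : Agree (atomThreshold a b) α β) :
    clamp 2 (a.pos α - b.pos α) = clamp 2 (a.pos β - b.pos β) := by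
  simpa [atomThreshold] using h a b

theorem Invariant.eq {m : ℕ} (a b : Term m) : Invariant (.eq a b) (atomThreshold a b) := by
  intro n n' α β h
  have := h.atom
  rw [clamp_eq_clamp_iff] at this
  simp only [Formula.Sat, Fin.ext_iff]
  simp only [Term.pos] at this
  omega

theorem Invariant.lt {m : ℕ} (a b : Term m) : Invariant (.lt a b) (atomThreshold a b) := by
  intro n n' α β h
  have := h.atom
  rw [clamp_eq_clamp_iff] at this
  simp only [Formula.Sat, Fin.lt_def]
  simp only [Term.pos] at this
  omega

/-- Only this atom requires the threshold 2, to tell a difference of 1 from larger ones. -/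
theorem Invariant.succ {m : ℕ} (a b : Term m) : Invariant (.succ a b) (atomThreshold a b) := by
  intro n n' α β h
  have := h.atom
  rw [clamp_eq_clamp_iff] at this
  simp only [Formula.Sat, Fin.covBy_iff, Nat.covBy_iff_add_one_eq]
  simp only [Term.pos] at this
  omega

/-! ### Growth of the thresholds -/

/-- Bounds on the thresholds between two variables (centre bound `c`) and between variables and the
endpoints (border bound `b`). -/
structure Bounded (δ : Term 3 → Term 3 → ℕ) (c b : ℕ) : Prop where
  symm : ∀ u v, δ u v = δ v u
  center : ∀ i j k : Fin 3, i ≠ j → j ≠ k → i ≠ k →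
    δ (.var i) (.var j) + δ (.var j) (.var k) ≤ c
  ends : δ .min .max ≤ b
  border : ∀ i j : Fin 3, δ .min (.var i) + δ (.var j) .max ≤ b

theorem Bounded.mono {δ : Term 3 → Term 3 → ℕ} {c b c' b' : ℕ} (h : Bounded δ c b) (hc : c ≤ c')
    (hb : b ≤ b') : Bounded δ c' b' :=
  ⟨h.symm, fun i j k h₁ h₂ h₃ => (h.center i j k h₁ h₂ h₃).trans hc, h.ends.trans hb,
    fun i j => (h.border i j).trans hb⟩

theorem Bounded.var_var_le {δ : Term 3 → Term 3 → ℕ} {c b : ℕ} (h : Bounded δ c b) {i j : Fin 3}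
    (hij : i ≠ j) : δ (.var i) (.var j) ≤ c := by
  obtain ⟨k, hk₁, hk₂⟩ : ∃ k : Fin 3, j ≠ k ∧ i ≠ k := by
    revert i j; decide
  exact le_of_add_le_left (h.center i j k hij hk₁ hk₂)

theorem Bounded.max {δ δ' : Term 3 → Term 3 → ℕ} {c b c' b' : ℕ} (h : Bounded δ c b)
    (h' : Bounded δ' c' b') : Bounded (fun u v => max (δ u v) (δ' u v)) (c + c') (b + b') where
  symm u v := by rw [h.symm, h'.symm]
  center i j k h₁ h₂ h₃ := by
    have := h.center i j k h₁ h₂ h₃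
    have := h'.center i j k h₁ h₂ h₃
    omega
  ends := by
    have := h.ends
    have := h'.ends
    omega
  border i j := by
    have := h.border i j
    have := h'.border i j
    omega

/-- The thresholds at `x` become 0, since its old value is forgotten. Of any two sides of the
triangle at most one survives, and its new value is bounded by the two old sides through `x`. A
border sum takes at most two detours through `x`, each costing at most `c + (t - 1)`. -/
theorem Bounded.quantThreshold {δ : Term 3 → Term 3 → ℕ} {c b : ℕ} (h : Bounded δ c b) (t : ℕ)
    (x : Fin 3) : Bounded (quantThreshold t x δ) (c + (t - 1)) (b + 2 * c + 2 * (t - 1)) where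
  symm u v := by
    unfold CountingLogic.quantThreshold
    simp only [h.symm u v, h.symm u (.var x), h.symm (.var x) v, add_comm (δ (.var x) u)]
    congr 1
    exact propext or_comm
  center i j k h₁ h₂ h₃ := by
    unfold CountingLogic.quantThreshold
    have hx : x = i ∨ x = j ∨ x = k := by
      revert i j k x; decide
    rcases hx with rfl | rfl | rfl
    · have := h.center j x k h₁.symm h₃ h₂
      have := h.var_var_le h₂
      simp [h₁.symm, h₃.symm]
      omega
    · simp
    · have := h.center i x j h₃ h₂.symm h₁
      have := h.var_var_le h₁
      simp [h₂, h₃]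
      omega
  ends := by
    have := h.ends
    have := h.border x x
    simp [CountingLogic.quantThreshold]
    omega
  border i j := by
    have h1 := h.border x x
    have h2 := h.border i j
    have h3 := h.border x j
    have h4 := h.border i x
    have h5 : i ≠ x → δ (.var x) (.var i) ≤ c := fun hi => h.var_var_le hi.symm
    have h6 : j ≠ x → δ (.var j) (.var x) ≤ c := fun hj => h.var_var_le hj
    by_cases hi : i = x <;> by_cases hj : j = x <;>
      simp [CountingLogic.quantThreshold, hi, hj]
    · have := h6 hj
      omega
    · have := h5 hi
      omega
    · have := h5 hi
      have := h6 hj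
      omega

theorem bounded_atomThreshold (a b : Term 3) :
    ∃ l₁ l₂ : ℕ, l₁ + l₂ = 1 ∧ Bounded (atomThreshold a b) (2 * l₁) (2 * l₂) := by
  have hsymm : ∀ u v, atomThreshold a b u v = atomThreshold a b v u := by
    intro u v
    unfold atomThreshold
    congr 1
    exact propext ⟨by tauto, by tauto⟩
  -- Atoms between two variables count towards the centre, all others towards the border.
  by_cases hab : ∃ i j, a = .var i ∧ b = .var j
  · obtain ⟨i, j, rfl, rfl⟩ := hab
    refine ⟨1, 0, rfl, hsymm, ?_, by simp [atomThreshold], by simp [atomThreshold]⟩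
    intro i' j' k' h₁ h₂ h₃
    simp only [atomThreshold, Term.var.injEq]
    split_ifs <;> omega
  · refine ⟨0, 1, rfl, hsymm, ?_, ?_, ?_⟩
    · intro i' j' k' h₁ h₂ h₃
      simp only [atomThreshold]
      split_ifs <;> grind
    · unfold atomThreshold
      split_ifs <;> simp
    · intro i j
      simp only [atomThreshold]
      split_ifs <;> grind

/-- `φ` is invariant for thresholds that are bounded in terms of numbers `l₁`, `l₂` of atoms and a
number `q` of quantifiers. -/
theorem exists_invariant {t : ℕ} (φ : Formula 3) (hφ : φ.countingRank ≤ t) :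
    ∃ (δ : Term 3 → Term 3 → ℕ) (l₁ l₂ q : ℕ), l₁ + l₂ + q ≤ φ.size ∧ Invariant φ δ ∧
      Bounded δ (2 * l₁ + q * (t - 1)) (2 * l₂ + 4 * q * l₁ + (t - 1) * (q * (q + 1))) := by
  have atom : ∀ (φ : Formula 3) (a b : Term 3), φ.size = 1 → Invariant φ (atomThreshold a b) →
      ∃ (δ : Term 3 → Term 3 → ℕ) (l₁ l₂ q : ℕ), l₁ + l₂ + q ≤ φ.size ∧ Invariant φ δ ∧
      Bounded δ (2 * l₁ + q * (t - 1)) (2 * l₂ + 4 * q * l₁ + (t - 1) * (q * (q + 1))) := by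
    intro φ a b hs h
    obtain ⟨l₁, l₂, hl, hB⟩ := bounded_atomThreshold a b
    exact ⟨_, l₁, l₂, 0, by omega, h, by simpa using hB⟩
  have arith : ∀ l₁ l₂ q l₁' l₂' q' : ℕ,
      (2 * l₂ + 4 * q * l₁ + (t - 1) * (q * (q + 1))) +
        (2 * l₂' + 4 * q' * l₁' + (t - 1) * (q' * (q' + 1))) ≤
      2 * (l₂ + l₂') + 4 * (q + q') * (l₁ + l₁') +
        (t - 1) * ((q + q') * (q + q' + 1)) := by
    intro l₁ l₂ q l₁' l₂' q'
    generalize t - 1 = r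
    have h1 := Nat.zero_le (q * l₁')
    have h2 := Nat.zero_le (q' * l₁)
    have h3 := Nat.zero_le (r * (q * q'))
    nlinarith
  induction φ with
  | eq a b => exact atom _ a b rfl (.eq a b)
  | lt a b => exact atom _ a b rfl (.lt a b)
  | succ a b => exact atom _ a b rfl (.succ a b)
  | neg φ ih =>
    obtain ⟨δ, l₁, l₂, q, hs, hI, hB⟩ := ih hφ
    exact ⟨δ, l₁, l₂, q, hs.trans (Nat.le_succ _), hI.neg, hB⟩
  | or φ ψ ih ih' =>
    obtain ⟨δ, l₁, l₂, q, hs, hI, hB⟩ := ih ((le_max_left _ _).trans hφ)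
    obtain ⟨δ', l₁', l₂', q', hs', hI', hB'⟩ := ih' ((le_max_right _ _).trans hφ)
    exact ⟨_, l₁ + l₁', l₂ + l₂', q + q', by simp only [Formula.size]; omega, hI.or hI',
      (hB.max hB').mono (le_of_eq (by ring)) (arith _ _ _ _ _ _)⟩
  | and φ ψ ih ih' =>
    obtain ⟨δ, l₁, l₂, q, hs, hI, hB⟩ := ih ((le_max_left _ _).trans hφ)
    obtain ⟨δ', l₁', l₂', q', hs', hI', hB'⟩ := ih' ((le_max_right _ _).trans hφ)
    exact ⟨_, l₁ + l₁', l₂ + l₂', q + q', by simp only [Formula.size]; omega, hI.and hI',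
      (hB.max hB').mono (le_of_eq (by ring)) (arith _ _ _ _ _ _)⟩
  | existsGE k j φ ih =>
    obtain ⟨δ, l₁, l₂, q, hs, hI, hB⟩ := ih ((le_max_right _ _).trans hφ)
    exact ⟨_, l₁, l₂, q + 1, by simp only [Formula.size]; omega,
      hI.existsGE hB.symm ((le_max_left _ _).trans hφ) j,
      (hB.quantThreshold t j).mono (le_of_eq (by ring)) (le_of_eq (by ring))⟩
  | forallGE k j φ ih =>
    obtain ⟨δ, l₁, l₂, q, hs, hI, hB⟩ := ih ((le_max_right _ _).trans hφ)
    exact ⟨_, l₁, l₂, q + 1, by simp only [Formula.size]; omega,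
      hI.forallGE hB.symm ((le_max_left _ _).trans hφ) j,
      (hB.quantThreshold t j).mono (le_of_eq (by ring)) (le_of_eq (by ring))⟩

theorem border_le_sq {t l₁ l₂ q s : ℕ} (ht : 1 ≤ t) (h : l₁ + l₂ + q ≤ s) :
    2 * l₂ + 4 * q * l₁ + (t - 1) * (q * (q + 1)) ≤ (s * t) ^ 2 + 1 := by
  obtain ⟨r, rfl⟩ := Nat.exists_eq_add_of_le' ht
  rw [Nat.add_sub_cancel]
  -- The `+ 1` is needed for a lone border atom (`l₂ = 1`); the strict bound `n < b` absorbs it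
  -- later.
  have h1 : 2 * l₂ + 4 * q * l₁ ≤ (l₁ + l₂ + q) ^ 2 + 1 := by
    zify
    rcases Nat.eq_zero_or_pos (l₁ + q) with h0 | h0
    · obtain ⟨rfl, rfl⟩ : l₁ = 0 ∧ q = 0 := by omega
      nlinarith [sq_nonneg ((l₂ : ℤ) - 1)]
    · have h0' : (1 : ℤ) ≤ l₁ + q := by exact_mod_cast h0
      have h2 : (0 : ℤ) ≤ l₂ := Int.natCast_nonneg _
      nlinarith [sq_nonneg ((l₁ : ℤ) - q), mul_nonneg h2 (sub_nonneg.2 h0'), sq_nonneg (l₂ : ℤ)]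
  have h2 : (l₁ + l₂ + q) ^ 2 ≤ s ^ 2 := Nat.pow_le_pow_left h 2
  have h3 : q * (q + 1) ≤ 2 * s ^ 2 := by
    have hq : q ^ 2 ≤ s ^ 2 := Nat.pow_le_pow_left (by omega) 2
    have hq' : q ≤ q ^ 2 := Nat.le_self_pow two_ne_zero q
    nlinarith
  have h4 : r * (q * (q + 1)) ≤ r * (2 * s ^ 2) := Nat.mul_le_mul_left r h3
  calc 2 * l₂ + 4 * q * l₁ + r * (q * (q + 1)) ≤ s ^ 2 + 1 + r * (2 * s ^ 2) := by omega
    _ ≤ s ^ 2 + 1 + r * (2 * s ^ 2) + r ^ 2 * s ^ 2 := Nat.le_add_right _ _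
    _ = (s * (r + 1)) ^ 2 + 1 := by ring

/-- Linear orders with more elements than the border bound are indistinguishable. -/
theorem Invariant.lt_of_distinguishes {φ : Formula 3} {δ : Term 3 → Term 3 → ℕ} {c b n m : ℕ}
    (hI : Invariant φ δ) (hB : Bounded δ c b) (hnm : n < m)
    (hdist : φ.Distinguishes (LinOrd n) (LinOrd m)) : n < b := by
  by_contra! hn
  -- With all variables at the minimum, the nonzero differences are ±n and ±m, which every relevant
  -- threshold truncates alike.
  refine hdist.2 (fun _ => ⊥) (hI (α := fun _ => ⊥) ?_ (hdist.1 _))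
  have hvar : ∀ (k : ℕ) (i : Fin 3),
      (Term.var i).pos (fun _ => ⊥ : Fin 3 → LinOrd k) = 0 := by
    intro k i
    simp [Term.pos, Term.val, bot_eq_zero]
  have hends := hB.ends
  have hmax : ∀ i, δ (.var i) .max ≤ b := fun i => (Nat.le_add_left _ _).trans (hB.border i i)
  rintro (i | _ | _) (j | _ | _) <;>
    simp only [Term.pos_min, Term.pos_max, hvar, sub_self] <;>
    rw [clamp_eq_clamp_iff]
  all_goals
    have h1 := hB.symm .max .min
    try have h2 := hmax i
    try have h3 := hmax j
    try have h4 := hB.symm .max (.var j)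
    omega

end CountingLogic

theorem theorem6 (t : ℕ) (ht : 1 ≤ t) (n m : ℕ) (hnm : n < m)
    (φ : CountingLogic.Formula 3) (hφ : φ.countingRank ≤ t)
    (hdist : φ.Distinguishes (CountingLogic.LinOrd n) (CountingLogic.LinOrd m)) :
    Real.sqrt (n : ℝ) / (t : ℝ) ≤ (φ.size : ℝ) := by
  obtain ⟨δ, l₁, l₂, q, hs, hI, hB⟩ := CountingLogic.exists_invariant φ hφ
  have hn : n ≤ (φ.size * t) ^ 2 := by
    have h1 := hI.lt_of_distinguishes hB hnm hdist
    have h2 := CountingLogic.border_le_sq ht hs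
    omega
  rw [div_le_iff₀ (by exact_mod_cast ht)]
  exact Real.sqrt_le_iff.2 ⟨by positivity, by exact_mod_cast hn⟩
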